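/- Let $\mathcal H$ be an infinite-dimensional separable complex Hilbert space and let $T$ be a bounded linear operator on $\mathcal H$ that is hypercyclic, i.e. there is $x\in\mathcal H$ whose orbit $\{T^n x : n=0,1,2,\dots\}$ is dense in $\mathcal H$. For a bounded operator $S$ on $\mathcal H$ let $\alpha(S)=\dim\ker S$ and $\beta(S)=\dim(\mathcal H/\operatorname{ran}S)$, both in $\{0,1,2,\dots,\infty\}$. Call $S$ upper semi-Fredholm if $\operatorname{ran}S$ is closed and $\alpha(S)<\infty$; lower semi-Fredholm if $\operatorname{ran}S$ is closed and $\beta(S)<\infty$; semi-Fredholm if it is upper or lower semi-Fredholm; Fredholm if it is both. The index of a semi-Fredholm operator is $\operatorname{ind}(S)=\alpha(S)-\beta(S)\in\mathbb Z\cup\{\pm\infty\}$. Let $\sigma(T)$ be the spectrum of $T$ and put $$\sigma_a(T)=\{\lambda\in\mathbb C : T-\lambda I \text{ is not bounded below}\},$$ $$\sigma_e(T)=\{\lambda\in\mathbb C : T-\lambda I\text{ is not Fredholm}\},$$ $$\sigma_{le}(T)=\{\lambda\in\mathbb C : T-\lambda I\text{ is not upper semi-Fredholm}\},$$ $$\sigma_{re}(T)=\{\lambda\in\mathbb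 C : T-\lambda I\text{ is not lower semi-Fredholm}\},$$ $$\sigma_{uw}(T)=\{\lambda\in\mathbb C : T-\lambda I\text{ is not semi-Fredholm with index}\le 0\},$$ $$E(T)=\{\lambda : \lambda\text{ is an isolated point of }\sigma(T)\text{ and }\alpha(T-\lambda I)>0\}.$$ Write $\mathbb T=\{z\in\mathbb C:|z|=1\}$ and suppose that at least one of the following holds: 1. $\sigma_e(T)\cap\mathbb T=\emptyset$; 2. $\sigma_{le}(T)\cap\mathbb T=\emptyset$; 3. $\sigma_{re}(T)\cap\mathbb T=\emptyset$; 4. $\partial\sigma_e(T)\cap\mathbb T=\emptyset$, where $\partial$ denotes the topological boundary in $\mathbb C$. Then $T$ satisfies property $(V_E)$, that is, $\sigma(T)\setminus\sigma_{uw}(T)=E(T)$, and consequently also property $(UW_E)$, that is, $\sigma_a(T)\setminus\sigma_{uw}(T)=E(T)$. -/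

import Mathlib

noncomputable section

namespace WeylType

variable {H : Type*} [NormedAddCommGroup H] [InnerProductSpace ℂ H]

/-- The operator `T - μ I`. -/
def shift (T : H →L[ℂ] H) (μ : ℂ) : H →L[ℂ] H :=
  T - μ • ContinuousLinearMap.id ℂ H

/-- The orbit `{T ^ n x : n = 0, 1, 2, …}` of `x` under `T`. -/
def orbit (T : H →L[ℂ] H) (x : H) : Set H :=
  Set.range fun n : ℕ => (T ^ n) x

/-- `T` is hypercyclic: some vector has a dense orbit. -/
def IsHypercyclic (T : H →L[ℂ] H) : Prop :=
  ∃ x : H, Dense (orbit T x)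

/-- The nullity: the dimension of the kernel, as an extended natural number. -/
def nullity (T : H →L[ℂ] H) : ℕ∞ :=
  Cardinal.toENat (Module.rank ℂ T.toLinearMap.ker)

/-- The defect: the (algebraic) codimension of the range, as an extended natural number. -/
def defect (T : H →L[ℂ] H) : ℕ∞ :=
  Cardinal.toENat (Module.rank ℂ (H ⧸ T.toLinearMap.range))

/-- Upper semi-Fredholm: finite nullity and closed range. -/
def IsUpperSemiFredholm (T : H →L[ℂ] H) : Prop :=
  nullity T < ⊤ ∧ IsClosed (Set.range T)

/-- Lower semi-Fredholm: finite defect and closed range. -/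
def IsLowerSemiFredholm (T : H →L[ℂ] H) : Prop :=
  defect T < ⊤ ∧ IsClosed (Set.range T)

/-- Semi-Fredholm: upper or lower semi-Fredholm. -/
def IsSemiFredholm (T : H →L[ℂ] H) : Prop :=
  IsUpperSemiFredholm T ∨ IsLowerSemiFredholm T

/-- Fredholm: both upper and lower semi-Fredholm. -/
def IsFredholm (T : H →L[ℂ] H) : Prop :=
  IsUpperSemiFredholm T ∧ IsLowerSemiFredholm T

/-- The index `nullity - defect`, an extended real number. It is used only for semi-Fredholm
operators, for which at most one of the two terms is infinite. -/
def index (T : H →L[ℂ] H) : EReal :=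
  ((nullity T : ENNReal) : EReal) - ((defect T : ENNReal) : EReal)

/-- Upper semi-Weyl: semi-Fredholm with index at most zero. -/
def IsUpperSemiWeyl (T : H →L[ℂ] H) : Prop :=
  IsSemiFredholm T ∧ index T ≤ 0

/-- The approximate point spectrum: those `μ` for which `T - μ I` is not bounded below. -/
def approxSpectrum (T : H →L[ℂ] H) : Set ℂ :=
  {μ | ¬ ∃ c : ℝ, 0 < c ∧ ∀ x : H, c * ‖x‖ ≤ ‖shift T μ x‖}

/-- The essential spectrum. -/
def essSpectrum (T : H →L[ℂ] H) : Set ℂ :=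
  {μ | ¬ IsFredholm (shift T μ)}

/-- The left essential spectrum. -/
def leftEssSpectrum (T : H →L[ℂ] H) : Set ℂ :=
  {μ | ¬ IsUpperSemiFredholm (shift T μ)}

/-- The right essential spectrum. -/
def rightEssSpectrum (T : H →L[ℂ] H) : Set ℂ :=
  {μ | ¬ IsLowerSemiFredholm (shift T μ)}

/-- The upper semi-Weyl spectrum. -/
def upperWeylSpectrum (T : H →L[ℂ] H) : Set ℂ :=
  {μ | ¬ IsUpperSemiWeyl (shift T μ)}

/-- The isolated points of a set of complex numbers. -/
def isolatedPoints (S : Set ℂ) : Set ℂ :=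
  {μ | μ ∈ S ∧ ∃ r : ℝ, 0 < r ∧ ∀ z ∈ S, dist z μ < r → z = μ}

/-- The set `E(T)` of isolated points of the spectrum that are eigenvalues of `T`. -/
def isolatedEigenvalues (T : H →L[ℂ] H) : Set ℂ :=
  {μ | μ ∈ isolatedPoints (spectrum ℂ T) ∧ 0 < nullity (shift T μ)}

/-- Property `(V_E)`. -/
def PropertyVE (T : H →L[ℂ] H) : Prop :=
  spectrum ℂ T \ upperWeylSpectrum T = isolatedEigenvalues T

/-- Property `(UW_E)`. -/
def PropertyUWE (T : H →L[ℂ] H) : Prop :=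
  approxSpectrum T \ upperWeylSpectrum T = isolatedEigenvalues T

end WeylType

end

/-! Both properties hold because every set involved is empty. The adjoint of a hypercyclic operator
has no eigenvalues, so `T - μ` has dense range; if it is semi-Fredholm it is onto, and index at most
zero then makes it invertible. Hence the spectrum lies in `upperWeylSpectrum T`.

For E(T), let `μ` be an isolated eigenvalue. The Riesz projection at `μ` is nonzero and commutes
with `T`; if `‖μ‖ ≠ 1`, powers of `T` or of its inverse stay bounded on its range, which a dense
orbit forbids. So `μ` is unimodular. But `T - μ` is not onto, since a right-invertible operator that
is a limit of invertible ones is invertible. So `μ` lies in all the essential spectra and on the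
boundary of `essSpectrum T`, against each of the four hypotheses. -/

namespace WeylType

open Metric

/-! ### Contour integrals of the resolvent -/

section Banach

variable {A : Type*} [NormedRing A] [NormedAlgebra ℂ A] [CompleteSpace A]

theorem circleIntegral_clm_comp {E F : Type*} [NormedAddCommGroup E] [NormedSpace ℂ E]
    [CompleteSpace E] [NormedAddCommGroup F] [NormedSpace ℂ F] [CompleteSpace F]
    (L : E →L[ℂ] F) {g : ℂ → E} {c : ℂ} {r : ℝ} (hg : CircleIntegrable g c r) :
    (∮ z in C(c, r), L (g z)) = L (∮ z in C(c, r), g z) := by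
  simp only [circleIntegral]
  rw [← L.intervalIntegral_comp_comm hg.out]
  simp

/-- The contour integral `∮ f(z) (z - a)⁻¹ dz`, a holomorphic functional calculus without its
normalising factor. -/
noncomputable def resolventIntegral (a : A) (c : ℂ) (r : ℝ) (f : ℂ → ℂ) : A :=
  ∮ z in C(c, r), f z • resolvent a z

variable {a : A} {c : ℂ} {r : ℝ} {f : ℂ → ℂ}

theorem continuousOn_resolvent (h : sphere c r ⊆ resolventSet ℂ a) :
    ContinuousOn (resolvent a) (sphere c r) := fun _ hz =>
  (spectrum.hasDerivAt_resolvent_const_left (h hz)).continuousAt.continuousWithinAt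

theorem circleIntegrable_smul_resolvent (hr : 0 ≤ r) (h : sphere c r ⊆ resolventSet ℂ a)
    (hf : ContinuousOn f (sphere c r)) :
    CircleIntegrable (fun z => f z • resolvent a z) c r :=
  (hf.smul (continuousOn_resolvent h)).circleIntegrable hr

omit [CompleteSpace A] in
theorem resolvent_mul_self {z : ℂ} (h : z ∈ resolventSet ℂ a) :
    resolvent a z * a = z • resolvent a z - 1 := by
  have h1 : resolvent a z * (algebraMap ℂ A z - a) = 1 := Ring.inverse_mul_cancel _ h
  rw [mul_sub, Algebra.algebraMap_eq_smul_one, mul_smul_comm, mul_one] at h1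
  rw [← h1]; abel

omit [CompleteSpace A] in
theorem self_mul_resolvent {z : ℂ} (h : z ∈ resolventSet ℂ a) :
    a * resolvent a z = z • resolvent a z - 1 := by
  have h1 : (algebraMap ℂ A z - a) * resolvent a z = 1 := Ring.mul_inverse_cancel _ h
  rw [sub_mul, Algebra.algebraMap_eq_smul_one, smul_mul_assoc, one_mul] at h1
  rw [← h1]; abel

theorem resolventIntegral_mul_comm (hr : 0 ≤ r) (h : sphere c r ⊆ resolventSet ℂ a)
    (hf : ContinuousOn f (sphere c r)) :
    resolventIntegral a c r f * a = a * resolventIntegral a c r f := by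
  have hI := circleIntegrable_smul_resolvent hr h hf
  have h1 := circleIntegral_clm_comp ((ContinuousLinearMap.mul ℂ A).flip a) hI
  have h2 := circleIntegral_clm_comp (ContinuousLinearMap.mul ℂ A a) hI
  simp only [ContinuousLinearMap.flip_apply, ContinuousLinearMap.mul_apply'] at h1 h2
  rw [resolventIntegral, ← h1, ← h2]
  refine circleIntegral.integral_congr hr fun z hz => ?_
  simp only [smul_mul_assoc, mul_smul_comm, resolvent_mul_self (h hz), self_mul_resolvent (h hz)]

/-- Multiplying the resolvent by `a` gives `z` times the resolvent minus 1; the extra term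
integrates to zero by Cauchy's theorem. -/
theorem resolventIntegral_mul_self (hr : 0 ≤ r) (h : sphere c r ⊆ resolventSet ℂ a)
    (hf : DifferentiableOn ℂ f (closedBall c r)) :
    resolventIntegral a c r f * a = resolventIntegral a c r fun z => z * f z := by
  have hfc : ContinuousOn f (sphere c r) := hf.continuousOn.mono sphere_subset_closedBall
  have h1 := circleIntegral_clm_comp ((ContinuousLinearMap.mul ℂ A).flip a)
    (circleIntegrable_smul_resolvent hr h hfc)
  simp only [ContinuousLinearMap.flip_apply, ContinuousLinearMap.mul_apply'] at h1
  have h2 : (∮ z in C(c, r), f z • (1 : A)) = 0 := by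
    rw [circleIntegral.integral_smul_const, Complex.circleIntegral_eq_zero_of_differentiable_on_off_countable hr
      Set.countable_empty hf.continuousOn, zero_smul]
    intro z hz
    exact (hf z (ball_subset_closedBall hz.1)).differentiableAt
      (mem_nhds_iff.2 ⟨ball c r, ball_subset_closedBall, isOpen_ball, hz.1⟩)
  have h3 : CircleIntegrable (fun z => f z • (1 : A)) c r :=
    (hfc.smul continuousOn_const).circleIntegrable hr
  have h4 : CircleIntegrable (fun z => (z * f z) • resolvent a z) c r :=
    circleIntegrable_smul_resolvent hr h (continuousOn_id.mul hfc)
  rw [resolventIntegral, ← h1, resolventIntegral, ← sub_zero (∮ z in C(c, r), (z * f z) • _), ← h2,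
    ← circleIntegral.integral_sub h4 h3]
  refine circleIntegral.integral_congr hr fun z hz => ?_
  simp only [smul_mul_assoc, resolvent_mul_self (h hz), smul_sub, smul_smul, mul_comm z]

/-- One constant serves all `f`, in particular all powers of `z` or of its inverse at once. -/
theorem exists_norm_resolventIntegral_le (hr : 0 ≤ r) (h : sphere c r ⊆ resolventSet ℂ a) :
    ∃ C : ℝ, ∀ f : ℂ → ℂ, (∀ z ∈ sphere c r, ‖f z‖ ≤ 1) → ‖resolventIntegral a c r f‖ ≤ C := by
  obtain ⟨M, hM⟩ := (isCompact_sphere c r).exists_bound_of_continuousOn (continuousOn_resolvent h)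
  refine ⟨2 * Real.pi * r * M, fun f hf =>
    circleIntegral.norm_integral_le_of_norm_le_const hr fun z hz => ?_⟩
  rw [norm_smul]
  exact (mul_le_of_le_one_left (norm_nonneg _) (hf z hz)).trans (hM z hz)

theorem resolventIntegral_one_mul_pow (hr : 0 ≤ r) (h : sphere c r ⊆ resolventSet ℂ a) (n : ℕ) :
    resolventIntegral a c r (fun _ => 1) * a ^ n = resolventIntegral a c r fun z => z ^ n := by
  induction n with
  | zero => simp
  | succ n ih =>
    rw [pow_succ, ← mul_assoc, ih, resolventIntegral_mul_self hr h (by fun_prop)]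
    simp only [pow_succ']

theorem resolventIntegral_inv_pow_mul_pow (hr : 0 ≤ r) (h : sphere c r ⊆ resolventSet ℂ a)
    (h0 : (0 : ℂ) ∉ closedBall c r) (n : ℕ) :
    resolventIntegral a c r (fun z => (z ^ n)⁻¹) * a ^ n =
      resolventIntegral a c r fun _ => 1 := by
  have hne : ∀ z ∈ closedBall c r, z ≠ 0 := fun z hz hz0 => h0 (hz0 ▸ hz)
  induction n with
  | zero => simp
  | succ n ih =>
    rw [pow_succ', ← mul_assoc, resolventIntegral_mul_self hr h, ← ih]
    · congr 1
      refine circleIntegral.integral_congr hr fun z hz => ?_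
      have := hne z (sphere_subset_closedBall hz)
      simp only [pow_succ']
      field_simp
    · exact DifferentiableOn.inv (by fun_prop) fun z hz => pow_ne_zero _ (hne z hz)

end Banach

/-! ### Dense orbits and bounded maps -/

variable {H : Type*} [NormedAddCommGroup H] [InnerProductSpace ℂ H]

theorem IsHypercyclic.eq_zero_of_bounded {F : Type*} [NormedAddCommGroup F] [NormedSpace ℂ F]
    {T : H →L[ℂ] H} {x : H} (hx : Dense (orbit T x)) (L : H →L[ℂ] F) {C : ℝ}
    (hC : ∀ n : ℕ, ‖L ((T ^ n) x)‖ ≤ C) : L = 0 := by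
  have hall : ∀ y, ‖L y‖ ≤ C := by
    have hcl : IsClosed {y | ‖L y‖ ≤ C} := isClosed_le (by fun_prop) continuous_const
    have hsub : orbit T x ⊆ {y | ‖L y‖ ≤ C} := by rintro _ ⟨n, rfl⟩; exact hC n
    exact fun y => hcl.closure_subset_iff.2 hsub (hx y)
  ext y
  by_contra hy
  have hpos : 0 < ‖L y‖ := norm_pos_iff.2 hy
  obtain ⟨n, hn⟩ := exists_nat_gt (C / ‖L y‖)
  have h1 := hall ((n : ℂ) • y)
  rw [map_smul, norm_smul, Complex.norm_natCast] at h1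
  rw [div_lt_iff₀ hpos] at hn
  linarith

/-- The orbit comes arbitrarily close to 0. -/
theorem IsHypercyclic.apply_eq_zero_of_le {F : Type*} [NormedAddCommGroup F] [NormedSpace ℂ F]
    {T : H →L[ℂ] H} {x : H} (hx : Dense (orbit T x)) (L : H →L[ℂ] F) {C : ℝ}
    (hC : ∀ n : ℕ, ‖L x‖ ≤ C * ‖(T ^ n) x‖) : L x = 0 := by
  have hcl : IsClosed {y : H | ‖L x‖ ≤ C * ‖y‖} := isClosed_le continuous_const (by fun_prop)
  have hsub : orbit T x ⊆ {y : H | ‖L x‖ ≤ C * ‖y‖} := by rintro _ ⟨n, rfl⟩; exact hC n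
  simpa using hcl.closure_subset_iff.2 hsub (hx 0)

/-- The adjoint of a hypercyclic operator has no eigenvalues. -/
theorem IsHypercyclic.functional_eq_zero {T : H →L[ℂ] H} (hT : IsHypercyclic T) {μ : ℂ}
    (φ : H →L[ℂ] ℂ) (hφ : ∀ y, φ (T y) = μ * φ y) : φ = 0 := by
  obtain ⟨x, hx⟩ := hT
  have hpow : ∀ n : ℕ, φ ((T ^ n) x) = μ ^ n * φ x := by
    intro n
    induction n with
    | zero => simp
    | succ n ih => rw [pow_succ', mul_apply_eq_comp, hφ, ih, pow_succ', mul_assoc]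
  rcases le_total ‖μ‖ 1 with hμ | hμ
  · refine IsHypercyclic.eq_zero_of_bounded hx φ (C := ‖φ x‖) fun n => ?_
    rw [hpow, norm_mul, norm_pow]
    exact mul_le_of_le_one_left (norm_nonneg _) (pow_le_one₀ (norm_nonneg _) hμ)
  · have h0 : φ x = 0 := by
      refine IsHypercyclic.apply_eq_zero_of_le hx φ (C := ‖φ‖) fun n => ?_
      refine le_trans ?_ (φ.le_opNorm _)
      rw [hpow, norm_mul, norm_pow]
      exact le_mul_of_one_le_left (norm_nonneg _) (one_le_pow₀ hμ)
    refine IsHypercyclic.eq_zero_of_bounded hx φ (C := 0) fun n => ?_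
    rw [hpow, h0]; simp

theorem shift_apply (T : H →L[ℂ] H) (μ : ℂ) (y : H) : shift T μ y = T y - μ • y := by
  simp [shift]

theorem shift_eq_neg (T : H →L[ℂ] H) (μ : ℂ) :
    shift T μ = -(algebraMap ℂ (H →L[ℂ] H) μ - T) := by
  ext y; simp [shift_apply, Algebra.algebraMap_eq_smul_one]

theorem mem_spectrum_iff_shift {T : H →L[ℂ] H} {μ : ℂ} :
    μ ∈ spectrum ℂ T ↔ ¬ IsUnit (shift T μ) := by
  rw [spectrum.mem_iff, shift_eq_neg, IsUnit.neg_iff]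

theorem nullity_eq_zero_iff {S : H →L[ℂ] H} : nullity S = 0 ↔ Function.Injective S := by
  rw [nullity, Cardinal.toENat_eq_zero, Submodule.rank_eq_zero]
  exact LinearMap.ker_eq_bot

/-! ### Surjectivity of shifts and isolated points -/

variable [CompleteSpace H]

/-- A vector orthogonal to the range would represent an eigenfunctional of the adjoint. -/
theorem IsHypercyclic.surjective_shift {T : H →L[ℂ] H} (hT : IsHypercyclic T) {μ : ℂ}
    (hcl : IsClosed (Set.range (shift T μ))) : Function.Surjective (shift T μ) := by
  set K : Submodule ℂ H := (shift T μ).toLinearMap.range with hK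
  have hKcl : IsClosed (K : Set H) := by
    rw [hK, LinearMap.coe_range]; exact hcl
  have : CompleteSpace K := hKcl.completeSpace_coe
  have hbot : Kᗮ = ⊥ := by
    rw [Submodule.eq_bot_iff]
    intro w hw
    have h0 : innerSL ℂ w = 0 := hT.functional_eq_zero (μ := μ) _ fun y => by
      have h1 : inner ℂ w (shift T μ y) = 0 :=
        Submodule.inner_left_of_mem_orthogonal (K := K) ⟨y, rfl⟩ hw
      rw [shift_apply, inner_sub_right, inner_smul_right, sub_eq_zero] at h1
      simpa using h1
    simpa using congrArg (fun φ : H →L[ℂ] ℂ => φ w) h0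
  have htop : K = ⊤ := Submodule.orthogonal_eq_bot_iff.1 hbot
  exact LinearMap.range_eq_top.1 htop

/-- `S` is bijective from the orthogonal complement of its kernel, so the open mapping theorem
inverts it there. -/
theorem exists_rightInverse_of_surjective {S : H →L[ℂ] H} (hS : Function.Surjective S) :
    ∃ R : H →L[ℂ] H, S * R = 1 := by
  set K : Submodule ℂ H := S.toLinearMap.ker with hK
  have : CompleteSpace K := S.isClosed_ker.completeSpace_coe
  have hker : (S ∘L Kᗮ.subtypeL).toLinearMap.ker = ⊥ := by
    rw [Submodule.eq_bot_iff]
    rintro ⟨y, hy⟩ hSy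
    have : y ∈ K ⊓ Kᗮ := ⟨hSy, hy⟩
    rw [Submodule.inf_orthogonal_eq_bot] at this
    simpa using this
  have hrange : (S ∘L Kᗮ.subtypeL).toLinearMap.range = ⊤ := by
    rw [LinearMap.range_eq_top]
    intro y
    obtain ⟨x, rfl⟩ := hS y
    obtain ⟨k, hk, w, hw, rfl⟩ := K.exists_add_mem_mem_orthogonal x
    refine ⟨⟨w, hw⟩, ?_⟩
    have : S k = 0 := hk
    simp [this]
  let e := ContinuousLinearEquiv.ofBijective (S ∘L Kᗮ.subtypeL) hker hrange
  refine ⟨Kᗮ.subtypeL ∘L e.symm.toContinuousLinearMap, ?_⟩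
  ext y
  exact e.apply_symm_apply y

theorem not_surjective_shift_of_mem_isolatedPoints {T : H →L[ℂ] H} {μ : ℂ}
    (hμ : μ ∈ isolatedPoints (spectrum ℂ T)) : ¬ Function.Surjective (shift T μ) := by
  intro hS
  obtain ⟨hmem, r, hr, hiso⟩ := hμ
  obtain ⟨R, hR⟩ := exists_rightInverse_of_surjective hS
  -- `t < r` makes the shift at `μ + t` invertible, and `t * ‖R‖ < 1` makes `1 - t R` invertible by
  -- a Neumann series; their relation then forces `R` to be a unit.
  obtain ⟨t, ht0, htr, ht1⟩ : ∃ t : ℝ, 0 < t ∧ t < r ∧ t * ‖R‖ < 1 := by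
    have hpos : 0 < ‖R‖ + 1 := by positivity
    refine ⟨min (r / 2) (1 / (‖R‖ + 1)), by positivity,
      (min_le_left _ _).trans_lt (by linarith), ?_⟩
    calc _ ≤ 1 / (‖R‖ + 1) * ‖R‖ := by gcongr; exact min_le_right _ _
      _ < 1 := by rw [one_div, inv_mul_lt_iff₀ hpos]; linarith
  have hunit : IsUnit (shift T (μ + t)) := by
    by_contra hn
    have := hiso (μ + t) (mem_spectrum_iff_shift.2 hn) (by simpa [abs_of_pos ht0] using htr)
    simp [ht0.ne'] at this
  have hprod : shift T (μ + t) * R = 1 - (t : ℂ) • R := by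
    have : shift T (μ + t) = shift T μ - (t : ℂ) • 1 := by
      ext y; simp [shift_apply, add_smul, sub_sub]
    rw [this, sub_mul, hR, smul_mul_assoc, one_mul]
  have hu2 : IsUnit (1 - (t : ℂ) • R) := by
    apply isUnit_one_sub_of_norm_lt_one
    rwa [norm_smul, Complex.norm_real, Real.norm_eq_abs, abs_of_pos ht0]
  rw [← hprod] at hu2
  have hRu : IsUnit R := by
    obtain ⟨u, hu⟩ := hunit
    rwa [← hu, Units.isUnit_units_mul] at hu2
  have hSu : IsUnit (shift T μ) := by
    obtain ⟨u, rfl⟩ := hRu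
    rw [Units.mul_eq_one_iff_eq_inv] at hR
    rw [hR]
    exact Units.isUnit _
  exact mem_spectrum_iff_shift.1 hmem hSu

/-! ### The Riesz projection at an isolated eigenvalue -/

theorem resolvent_apply_of_eigenvector {T : H →L[ℂ] H} {μ z : ℂ} {v : H} (hv : T v = μ • v)
    (hz : z ∈ resolventSet ℂ T) (hne : z ≠ μ) : resolvent T z v = (z - μ)⁻¹ • v := by
  have h1 := congrArg (fun S : H →L[ℂ] H => S v) (resolvent_mul_self hz)
  simp only [mul_apply_eq_comp, hv, map_smul, sub_apply,
    smul_apply, one_apply_eq_self] at h1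
  have h2 : (z - μ) • resolvent T z v = v := by rw [sub_smul, h1]; abel
  rw [eq_inv_smul_iff₀ (sub_ne_zero.2 hne), h2]

theorem resolventIntegral_one_apply_of_eigenvector {T : H →L[ℂ] H} {μ : ℂ} {v : H} {r : ℝ}
    (hr : 0 < r) (h : sphere μ r ⊆ resolventSet ℂ T) (hv : T v = μ • v) :
    resolventIntegral T μ r (fun _ => 1) v = (2 * Real.pi * Complex.I : ℂ) • v := by
  have h1 := circleIntegral_clm_comp (ContinuousLinearMap.apply ℂ H v)
    (circleIntegrable_smul_resolvent hr.le h (f := fun _ => 1) continuousOn_const)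
  simp only [ContinuousLinearMap.apply_apply] at h1
  rw [resolventIntegral, ← h1, ← circleIntegral.integral_sub_center_inv μ hr.ne',
    ← circleIntegral.integral_smul_const]
  refine circleIntegral.integral_congr hr.le fun z hz => ?_
  simp [resolvent_apply_of_eigenvector hv (h hz) (ne_of_mem_sphere hz hr.ne')]

/-- An eigenvalue of a hypercyclic operator that is isolated in the spectrum is unimodular. -/
theorem IsHypercyclic.norm_eq_one_of_mem_isolatedEigenvalues {T : H →L[ℂ] H}
    (hT : IsHypercyclic T) {μ : ℂ} (hμ : μ ∈ isolatedEigenvalues T) : ‖μ‖ = 1 := by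
  obtain ⟨⟨-, ρ, hρ, hiso⟩, hnull⟩ := hμ
  obtain ⟨v, hv0, hv⟩ : ∃ v : H, v ≠ 0 ∧ T v = μ • v := by
    by_contra! hcon
    refine hnull.ne' (nullity_eq_zero_iff.2 ?_)
    rw [injective_iff_map_eq_zero]
    intro v hv
    by_contra h0
    rw [shift_apply, sub_eq_zero] at hv
    exact hcon v h0 hv
  obtain ⟨x, hx⟩ := hT
  by_contra hne
  -- The second bound on `r` keeps the closed disc off the unit circle.
  obtain ⟨r, hr, hrρ, hr1⟩ : ∃ r : ℝ, 0 < r ∧ r < ρ ∧ r < |‖μ‖ - 1| := by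
    obtain ⟨r, h1, h2⟩ := exists_between (lt_min hρ (abs_pos.2 (sub_ne_zero.2 hne)))
    exact ⟨r, h1, lt_min_iff.1 h2⟩
  have hsub : sphere μ r ⊆ resolventSet ℂ T := by
    intro z hz
    by_contra hz'
    have hd : dist z μ = r := hz
    exact ne_of_mem_sphere hz hr.ne' (hiso z hz' (hd ▸ hrρ))
  obtain ⟨C, hC⟩ := exists_norm_resolventIntegral_le hr.le hsub
  have hP : resolventIntegral T μ r (fun _ => 1) ≠ 0 := by
    intro h0
    have := resolventIntegral_one_apply_of_eigenvector hr hsub hv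
    rw [h0, zero_apply] at this
    exact smul_ne_zero Complex.two_pi_I_ne_zero hv0 this.symm
  rcases lt_or_gt_of_ne hne with hlt | hgt
  -- Disc inside the unit disc: the functions `z ^ n` are bounded by 1 on the contour, so the
  -- projected orbit is bounded.
  · rw [abs_of_neg (by linarith)] at hr1
    refine hP (IsHypercyclic.eq_zero_of_bounded hx _ (C := C * ‖x‖) fun n => ?_)
    rw [← mul_apply_eq_comp, resolventIntegral_one_mul_pow hr.le hsub]
    refine ContinuousLinearMap.le_of_opNorm_le _ (hC _ fun z hz => ?_) x
    rw [norm_pow]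
    refine pow_le_one₀ (norm_nonneg _) ?_
    have hz' : ‖z - μ‖ = r := by simpa using hz
    have := norm_sub_norm_le z μ
    linarith
  -- Disc outside: the inverse powers are bounded by 1 on the contour, so the projection kills `x`,
  -- hence its whole orbit by commutation.
  · rw [abs_of_pos (by linarith)] at hr1
    have hbound : ∀ z ∈ closedBall μ r, 1 ≤ ‖z‖ := fun z hz => by
      have hz' : ‖μ - z‖ ≤ r := by rw [norm_sub_rev]; simpa [dist_eq_norm] using hz
      have := norm_sub_norm_le μ z
      linarith
    have h0 : (0 : ℂ) ∉ closedBall μ r := fun h => by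
      have := hbound 0 h
      norm_num at this
    have hPx : resolventIntegral T μ r (fun _ => 1) x = 0 := by
      refine IsHypercyclic.apply_eq_zero_of_le hx _ (C := C) fun n => ?_
      rw [← resolventIntegral_inv_pow_mul_pow hr.le hsub h0 n, mul_apply_eq_comp]
      refine ContinuousLinearMap.le_of_opNorm_le _ (hC _ fun z hz => ?_) _
      rw [norm_inv, norm_pow]
      exact inv_le_one_of_one_le₀ (one_le_pow₀ (hbound z (sphere_subset_closedBall hz)))
    refine hP (IsHypercyclic.eq_zero_of_bounded hx _ (C := 0) fun n => ?_)
    have hcomm : Commute (resolventIntegral T μ r fun _ => 1) T :=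
      resolventIntegral_mul_comm hr.le hsub continuousOn_const
    rw [← mul_apply_eq_comp, (hcomm.pow_right n).eq, mul_apply_eq_comp, hPx]
    simp

/-! ### Comparison of the spectra -/

theorem not_isSemiFredholm_of_mem_isolatedPoints {T : H →L[ℂ] H} (hT : IsHypercyclic T) {μ : ℂ}
    (hμ : μ ∈ isolatedPoints (spectrum ℂ T)) : ¬ IsSemiFredholm (shift T μ) := fun h =>
  not_surjective_shift_of_mem_isolatedPoints hμ
    (hT.surjective_shift (h.elim (fun h => h.2) fun h => h.2))

omit [CompleteSpace H] in
theorem defect_eq_zero_of_surjective {S : H →L[ℂ] H} (hS : Function.Surjective S) :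
    defect S = 0 := by
  have : S.toLinearMap.range = ⊤ := LinearMap.range_eq_top.2 hS
  rw [defect, this]
  simp

theorem spectrum_subset_upperWeylSpectrum {T : H →L[ℂ] H} (hT : IsHypercyclic T) :
    spectrum ℂ T ⊆ upperWeylSpectrum T := by
  rintro μ hμ ⟨hsf, hind⟩
  have hsurj := hT.surjective_shift (hsf.elim (fun h => h.2) fun h => h.2)
  have hnull : nullity (shift T μ) = 0 := by
    rw [index, defect_eq_zero_of_surjective hsurj] at hind
    have h : ((nullity (shift T μ) : ENNReal) : EReal) ≤ ((0 : ENNReal) : EReal) := by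
      simpa using hind
    simpa using EReal.coe_ennreal_le_coe_ennreal_iff.1 h
  exact mem_spectrum_iff_shift.1 hμ
    (ContinuousLinearMap.isUnit_iff_bijective.2 ⟨nullity_eq_zero_iff.1 hnull, hsurj⟩)

theorem essSpectrum_subset_spectrum (T : H →L[ℂ] H) : essSpectrum T ⊆ spectrum ℂ T := by
  intro μ hμ
  rw [mem_spectrum_iff_shift]
  intro hu
  obtain ⟨hinj, hsurj⟩ := ContinuousLinearMap.isUnit_iff_bijective.1 hu
  have hcl : IsClosed (Set.range (shift T μ)) := by rw [hsurj.range_eq]; exact isClosed_univ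
  exact hμ ⟨⟨by simp [nullity_eq_zero_iff.2 hinj], hcl⟩,
    ⟨by simp [defect_eq_zero_of_surjective hsurj], hcl⟩⟩

omit [CompleteSpace H] in
theorem approxSpectrum_subset_spectrum (T : H →L[ℂ] H) : approxSpectrum T ⊆ spectrum ℂ T := by
  intro μ hμ
  rw [mem_spectrum_iff_shift]
  rintro ⟨u, hu⟩
  refine hμ ⟨(‖(↑u⁻¹ : H →L[ℂ] H)‖ + 1)⁻¹, by positivity, fun x => ?_⟩
  rw [inv_mul_le_iff₀ (by positivity), ← hu]
  have h1 : (↑u⁻¹ : H →L[ℂ] H) ((↑u : H →L[ℂ] H) x) = x := by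
    rw [← mul_apply_eq_comp, Units.inv_mul, one_apply_eq_self]
  have h2 := (↑u⁻¹ : H →L[ℂ] H).le_opNorm ((↑u : H →L[ℂ] H) x)
  rw [h1] at h2
  nlinarith [norm_nonneg ((↑u : H →L[ℂ] H) x)]

/-- An interior point of `S'` would have other points of `S` arbitrarily near. -/
theorem mem_frontier_of_mem_isolatedPoints {S S' : Set ℂ} (hsub : S' ⊆ S) {μ : ℂ}
    (hμ : μ ∈ isolatedPoints S) (hmem : μ ∈ S') : μ ∈ frontier S' := by
  obtain ⟨-, r, hr, hiso⟩ := hμ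
  refine ⟨subset_closure hmem, fun hint => ?_⟩
  obtain ⟨ε, hε, hball⟩ := Metric.mem_nhds_iff.1 (mem_interior_iff_mem_nhds.1 hint)
  obtain ⟨t, ht0, ht⟩ := exists_between (lt_min hr hε)
  rw [lt_min_iff] at ht
  have hd : dist (μ + t) μ = t := by simp [abs_of_pos ht0]
  have := hiso (μ + t) (hsub (hball (by rw [mem_ball, hd]; exact ht.2))) (by rw [hd]; exact ht.1)
  simp [ht0.ne'] at this

theorem isolatedEigenvalues_eq_empty {T : H →L[ℂ] H} (hT : IsHypercyclic T)
    (hcond :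
      essSpectrum T ∩ sphere (0 : ℂ) 1 = ∅ ∨
      leftEssSpectrum T ∩ sphere (0 : ℂ) 1 = ∅ ∨
      rightEssSpectrum T ∩ sphere (0 : ℂ) 1 = ∅ ∨
      frontier (essSpectrum T) ∩ sphere (0 : ℂ) 1 = ∅) :
    isolatedEigenvalues T = ∅ := by
  rw [Set.eq_empty_iff_forall_notMem]
  intro μ hμ
  have hs : μ ∈ sphere (0 : ℂ) 1 := by
    simpa using hT.norm_eq_one_of_mem_isolatedEigenvalues hμ
  have hsf := not_isSemiFredholm_of_mem_isolatedPoints hT hμ.1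
  have hess : μ ∈ essSpectrum T := fun h => hsf (Or.inl h.1)
  simp only [Set.eq_empty_iff_forall_notMem] at hcond
  rcases hcond with h | h | h | h
  · exact h μ ⟨hess, hs⟩
  · exact h μ ⟨fun h' => hsf (Or.inl h'), hs⟩
  · exact h μ ⟨fun h' => hsf (Or.inr h'), hs⟩
  · exact h μ ⟨mem_frontier_of_mem_isolatedPoints (essSpectrum_subset_spectrum T) hμ.1 hess, hs⟩

end WeylType

theorem corollary3p3 {H : Type*} [NormedAddCommGroup H] [InnerProductSpace ℂ H]
    [CompleteSpace H] [TopologicalSpace.SeparableSpace H]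
    (hdim : ¬ FiniteDimensional ℂ H)
    (T : H →L[ℂ] H) (hT : WeylType.IsHypercyclic T)
    (hcond :
      WeylType.essSpectrum T ∩ Metric.sphere (0 : ℂ) 1 = ∅ ∨
      WeylType.leftEssSpectrum T ∩ Metric.sphere (0 : ℂ) 1 = ∅ ∨
      WeylType.rightEssSpectrum T ∩ Metric.sphere (0 : ℂ) 1 = ∅ ∨
      frontier (WeylType.essSpectrum T) ∩ Metric.sphere (0 : ℂ) 1 = ∅) :
    WeylType.PropertyVE T ∧ WeylType.PropertyUWE T := by
  have hE := WeylType.isolatedEigenvalues_eq_empty hT hcond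
  have hW := WeylType.spectrum_subset_upperWeylSpectrum hT
  rw [WeylType.PropertyVE, WeylType.PropertyUWE, hE, Set.sdiff_eq_empty, Set.sdiff_eq_empty]
  exact ⟨hW, (WeylType.approxSpectrum_subset_spectrum T).trans hW⟩
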